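/- Let $K$ be a field and let $D$ be an integral domain that is a finitely generated $K$-algebra, with quotient field $Q(D)$ and unit group $U(D)$. Let $R(D)$ be the reciprocal complement of $D$, i.e. the subring of $Q(D)$ generated by the elements $1/x$ with $x\in D\setminus\{0\}$, let $K(U(D))$ be the subfield of $Q(D)$ generated by $K$ and $U(D)$, and let $\dim$ denote Krull dimension. Then $$\dim R(D)\leq \dim D-\operatorname{trdeg}(K(U(D))/K).$$ In particular, if $K$ is algebraically closed and $U(D)\neq K\setminus\{0\}$ (where $K$ is identified with its image in $D$), then $\dim R(D)<\dim D$. -/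

import Mathlib

/-- The reciprocal complement of an integral domain `D`: the subring of its quotient field
generated by the inverses of the nonzero elements of `D`. -/
noncomputable def reciprocalComplement (D : Type*) [CommRing D] [IsDomain D] :
    Subring (FractionRing D) :=
  Subring.closure {y | ∃ x : D, x ≠ 0 ∧ y = (algebraMap D (FractionRing D) x)⁻¹}

/-- The field `K(U(D))`: the subfield of the quotient field of `D` generated over `K` by the
units of `D`. -/
noncomputable def unitField (K D : Type*) [Field K] [CommRing D] [IsDomain D] [Algebra K D] :
    IntermediateField K (FractionRing D) :=
  IntermediateField.adjoin K (algebraMap D (FractionRing D) '' {d : D | IsUnit d})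

/-!
A ring containing a field `L` has Krull dimension at most its transcendence degree over `L`. Every
element of `K(U(D))` is a quotient `r / s` in which `r` is a sum of units of `D` and `s ∈ D`; both
`r` and `1 / s` lie in `R(D)`, so `R(D)` contains the field `L = K(U(D))`. Hence
`dim R(D) ≤ trdeg (Q(D) / L) = trdeg (Q(D) / K) - trdeg (L / K)`, and
`trdeg (Q(D) / K) = dim D` because `D` is affine.
-/

open Cardinal Algebra

universe u v w

section TranscendenceDegree

theorem transcendental_of_injOn_of_map_eq_zero {F S T : Type*} [CommRing F] [CommRing S]
    [IsDomain S] [CommRing T] [Algebra F S] [Algebra F T] (f : S →ₐ[F] T) {A : Subalgebra F S}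
    (hA : Set.InjOn f A) {x : S} (hx : f x = 0) (hx0 : x ≠ 0) : Transcendental A x := by
  intro halg
  refine Ideal.comap_ne_bot_of_algebraic_mem (I := RingHom.ker f) hx0 hx halg ?_
  exact eq_bot_iff.mpr fun a ha ↦ Subtype.ext (hA a.2 A.zero_mem (ha.trans (map_zero f).symm))

theorem lift_trdeg_add_one_le_of_surjective {F : Type w} {S : Type u} {T : Type v} [CommRing F]
    [CommRing S] [IsDomain S] [CommRing T] [NoZeroDivisors T] [Algebra F S] [Algebra F T]
    [FaithfulSMul F T] (f : S →ₐ[F] T) (hsurj : Function.Surjective f)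
    (hinj : ¬ Function.Injective f) :
    lift.{u} (trdeg F T) + 1 ≤ lift.{v} (trdeg F S) := by
  obtain ⟨x, hx, hx0⟩ : ∃ x, f x = 0 ∧ x ≠ 0 := by
    simpa only [injective_iff_map_eq_zero, not_forall, exists_prop] using hinj
  obtain ⟨ι, b, hb⟩ := exists_isTranscendenceBasis' F T
  obtain ⟨y, rfl⟩ : ∃ y : ι → S, f ∘ y = b := hsurj.comp_left b
  have hy : AlgebraicIndependent F y := hb.1.of_comp f
  have hinjOn : Set.InjOn f (adjoin F (Set.range y)) := by
    rw [adjoin_range_eq_range_aeval]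
    refine Function.Injective.injOn_range (f := MvPolynomial.aeval y) ?_
    rw [← AlgHom.coe_comp, MvPolynomial.comp_aeval]
    exact hb.1
  have : Nontrivial F := (algebraMap F S).domain_nontrivial
  have hxy : AlgebraicIndependent F fun o : Option ι ↦ o.elim x y :=
    AlgebraicIndependent.option_iff.mpr
      ⟨hy, transcendental_of_injOn_of_map_eq_zero f hinjOn hx hx0⟩
  rw [← hb.cardinalMk_eq_trdeg]
  simpa using hxy.lift_cardinalMk_le_trdeg

theorem trdeg_fractionRing (K D : Type*) [CommRing K] [CommRing D] [IsDomain D] [Algebra K D]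
    [FaithfulSMul K D] : trdeg K (FractionRing D) = trdeg K D := by
  have : Nontrivial K := (algebraMap K D).domain_nontrivial
  have : Algebra.IsAlgebraic D (FractionRing D) := IsLocalization.isAlgebraic _ (nonZeroDivisors D)
  rw [← trdeg_add_eq K D (A := FractionRing D), trdeg_eq_zero (R := D), add_zero]

end TranscendenceDegree

section KrullDimension

theorem ringKrullDim_le_trdeg (F R : Type*) [Field F] [CommRing R] [Algebra F R] :
    ringKrullDim R ≤ (toENat (trdeg F R) : ℕ∞) := by
  have length_le (p : LTSeries (PrimeSpectrum R)) :
      (p.length : ℕ∞) ≤ toENat (trdeg F (R ⧸ p.head.asIdeal)) := by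
    induction p using RelSeries.inductionOn with
    | singleton => simp
    | cons p x hx ih =>
      have hlt : x.asIdeal < p.head.asIdeal := hx
      have hinj : ¬ Function.Injective (Ideal.Quotient.factorₐ F hlt.le) := by
        intro hinj
        refine hlt.not_ge fun a ha ↦ ?_
        rw [← Ideal.Quotient.eq_zero_iff_mem] at ha ⊢
        exact hinj (by simpa using ha)
      have htrdeg := OrderHomClass.mono toENat <| lift_trdeg_add_one_le_of_surjective
        (Ideal.Quotient.factorₐ F hlt.le) (Ideal.Quotient.factor_surjective hlt.le) hinj
      simp only [lift_id, map_add, map_one] at htrdeg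
      simp only [RelSeries.cons_length, RelSeries.head_cons, Nat.cast_add, Nat.cast_one]
      exact (add_le_add_left ih 1).trans htrdeg
  refine iSup_le fun p ↦ WithBot.coe_le_coe.mpr ((length_le p).trans ?_)
  exact OrderHomClass.mono toENat
    (trdeg_le_of_surjective (Ideal.Quotient.mkₐ F _) Ideal.Quotient.mk_surjective)

theorem ringKrullDim_le_of_isIntegral (A B : Type*) [CommRing A] [CommRing B] [Algebra A B]
    [Algebra.IsIntegral A B] [FaithfulSMul A B] : ringKrullDim A ≤ ringKrullDim B := by
  refine iSup_le fun p ↦ ?_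
  obtain ⟨P, _, _⟩ := (inferInstance : Nonempty (p.head.asIdeal.primesOver B))
  obtain ⟨q, hq, -⟩ := Ideal.exists_ltSeries_of_hasGoingUp p P
  rw [← hq]
  exact Order.LTSeries.length_le_krullDim q

theorem trdeg_le_ringKrullDim (K D : Type*) [Field K] [CommRing D] [IsDomain D] [Algebra K D]
    [FiniteType K D] : ((toENat (trdeg K D) : ℕ∞) : WithBot ℕ∞) ≤ ringKrullDim D := by
  obtain ⟨s, g, hg, hint⟩ := exists_integral_inj_algHom_of_fg K D
  let := g.toRingHom.toAlgebra
  have : IsScalarTower K (MvPolynomial (Fin s) K) D := .of_algHom g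
  have : Algebra.IsIntegral (MvPolynomial (Fin s) K) D := ⟨hint⟩
  have : FaithfulSMul (MvPolynomial (Fin s) K) D :=
    (faithfulSMul_iff_algebraMap_injective _ _).mpr hg
  have htrdeg : toENat (trdeg K D) = s := by
    have h := lift_trdeg_add_eq K (MvPolynomial (Fin s) K) D
    rw [trdeg_eq_zero (R := MvPolynomial (Fin s) K), MvPolynomial.trdeg_of_isDomain] at h
    simpa using (congrArg toENat h).symm
  have hdim : ringKrullDim (MvPolynomial (Fin s) K) = s := by
    simp [MvPolynomial.ringKrullDim_of_isNoetherianRing]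
  rw [htrdeg]
  exact hdim.ge.trans (ringKrullDim_le_of_isIntegral _ D)

theorem ringKrullDim_eq_trdeg (K D : Type*) [Field K] [CommRing D] [IsDomain D] [Algebra K D]
    [FiniteType K D] : ringKrullDim D = (toENat (trdeg K D) : ℕ∞) :=
  (ringKrullDim_le_trdeg K D).antisymm (trdeg_le_ringKrullDim K D)

theorem exists_ringKrullDim_eq_natCast (K D : Type*) [Field K] [CommRing D] [IsDomain D]
    [Algebra K D] [FiniteType K D] : ∃ n : ℕ, ringKrullDim D = n := by
  obtain ⟨n, hn⟩ := lt_aleph0.mp (trdeg_lt_aleph0_of_finiteType (R := K) (S := D))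
  exact ⟨n, by simp [ringKrullDim_eq_trdeg K D, hn]⟩

theorem ringKrullDim_subring_add_trdeg_le {K E : Type*} [Field K] [Field E] [Algebra K E]
    {L : IntermediateField K E} {R : Subring E} (hLR : L.toSubfield.toSubring ≤ R) :
    ringKrullDim R + ((toENat (trdeg K L) : ℕ∞) : WithBot ℕ∞) ≤ (toENat (trdeg K E) : ℕ∞) := by
  let S : Subalgebra L E := { R with algebraMap_mem' := fun z ↦ hLR z.2 }
  have hdim : ringKrullDim R ≤ (toENat (trdeg L E) : ℕ∞) :=
    (ringKrullDim_le_trdeg L S).trans <| WithBot.coe_le_coe.mpr <|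
      OrderHomClass.mono toENat (trdeg_le_of_injective S.val Subtype.val_injective)
  rw [← trdeg_add_eq K L (A := E), map_add, add_comm, WithBot.coe_add]
  gcongr

end KrullDimension

section ReciprocalComplement

variable {K D : Type*} [Field K] [CommRing D] [IsDomain D] [Algebra K D]

theorem inv_algebraMap_mem_reciprocalComplement (x : D) :
    (algebraMap D (FractionRing D) x)⁻¹ ∈ reciprocalComplement D := by
  by_cases hx : x = 0
  · simp [hx]
  · exact Subring.subset_closure ⟨x, hx, rfl⟩

theorem algebraMap_mem_reciprocalComplement_of_isUnit {u : D} (hu : IsUnit u) :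
    algebraMap D (FractionRing D) u ∈ reciprocalComplement D := by
  obtain ⟨v, huv⟩ := hu.exists_right_inv
  have hinv : algebraMap D (FractionRing D) u = (algebraMap D (FractionRing D) v)⁻¹ :=
    eq_inv_of_mul_eq_one_left (by rw [← map_mul, huv, map_one])
  exact hinv ▸ inv_algebraMap_mem_reciprocalComplement v

theorem algebraMap_mem_reciprocalComplement_of_mem_adjoin {x : D}
    (hx : x ∈ adjoin K {u : D | IsUnit u}) :
    algebraMap D (FractionRing D) x ∈ reciprocalComplement D := by
  induction hx using adjoin_induction with
  | mem u hu => exact algebraMap_mem_reciprocalComplement_of_isUnit hu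
  | algebraMap c =>
    obtain rfl | hc := eq_or_ne c 0
    · simp
    · exact algebraMap_mem_reciprocalComplement_of_isUnit ((IsUnit.mk0 c hc).map _)
  | add x y _ _ hx hy => rw [map_add]; exact add_mem hx hy
  | mul x y _ _ hx hy => rw [map_mul]; exact mul_mem hx hy

theorem mem_unitField_iff_div {z : FractionRing D} :
    z ∈ unitField K D ↔ ∃ r ∈ adjoin K {u : D | IsUnit u}, ∃ s ∈ adjoin K {u : D | IsUnit u},
      z = algebraMap D (FractionRing D) r / algebraMap D (FractionRing D) s := by
  rw [unitField, IntermediateField.mem_adjoin_iff_div, adjoin_algebraMap]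
  constructor
  · rintro ⟨_, ⟨r, hr, rfl⟩, _, ⟨s, hs, rfl⟩, rfl⟩
    exact ⟨r, hr, s, hs, rfl⟩
  · rintro ⟨r, hr, s, hs, rfl⟩
    exact ⟨_, ⟨r, hr, rfl⟩, _, ⟨s, hs, rfl⟩, rfl⟩

theorem unitField_le_reciprocalComplement :
    (unitField K D).toSubfield.toSubring ≤ reciprocalComplement D := by
  intro z hz
  obtain ⟨r, hr, s, -, rfl⟩ := mem_unitField_iff_div.mp hz
  rw [div_eq_mul_inv]
  exact mul_mem (algebraMap_mem_reciprocalComplement_of_mem_adjoin hr)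
    (inv_algebraMap_mem_reciprocalComplement s)

theorem one_le_trdeg_unitField {u : D} (hu : IsUnit u) (hu' : Transcendental K u) :
    1 ≤ trdeg K (unitField K D) := by
  let z : unitField K D :=
    ⟨algebraMap D (FractionRing D) u, IntermediateField.subset_adjoin _ _ ⟨u, hu, rfl⟩⟩
  have hz : Transcendental K z := by
    rw [← transcendental_algebraMap_iff (A := FractionRing D) Subtype.val_injective]
    exact (transcendental_algebraMap_iff (IsFractionRing.injective D (FractionRing D))).mpr hu'
  exact Cardinal.one_le_iff_ne_zero.mpr (trdeg_ne_zero_iff.mpr ⟨z, hz⟩)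

theorem exists_isUnit_transcendental [IsAlgClosed K]
    (h : {u : D | IsUnit u} ≠ algebraMap K D '' {c : K | c ≠ 0}) :
    ∃ u : D, IsUnit u ∧ Transcendental K u := by
  by_contra! halg
  simp only [Transcendental, not_not] at halg
  refine h (Set.Subset.antisymm (fun u hu ↦ ?_) ?_)
  · obtain ⟨c, rfl⟩ := minpoly.mem_range_of_degree_eq_one K u <|
      IsAlgClosed.degree_eq_one_of_irreducible K (minpoly.irreducible (halg u hu).isIntegral)
    exact ⟨c, fun hc ↦ hu.ne_zero (by rw [hc, map_zero]), rfl⟩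
  · rintro _ ⟨c, hc, rfl⟩
    exact (IsUnit.mk0 c hc).map (algebraMap K D)

end ReciprocalComplement

theorem proposition3p10_general (K D : Type*) [Field K] [CommRing D] [IsDomain D] [Algebra K D]
    [FiniteType K D] :
    ringKrullDim (reciprocalComplement D) +
        ((toENat (trdeg K (unitField K D)) : ℕ∞) : WithBot ℕ∞) ≤ ringKrullDim D ∧
    ((∃ u : D, IsUnit u ∧ Transcendental K u) →
      ringKrullDim (reciprocalComplement D) < ringKrullDim D) := by
  have hle : ringKrullDim (reciprocalComplement D) +
      ((toENat (trdeg K (unitField K D)) : ℕ∞) : WithBot ℕ∞) ≤ ringKrullDim D := by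
    rw [ringKrullDim_eq_trdeg K D, ← trdeg_fractionRing K D]
    exact ringKrullDim_subring_add_trdeg_le unitField_le_reciprocalComplement
  refine ⟨hle, fun ⟨u, hu, hu'⟩ ↦ ?_⟩
  have hone : 1 ≤ ((toENat (trdeg K (unitField K D)) : ℕ∞) : WithBot ℕ∞) :=
    mod_cast one_le_toENat.mpr (one_le_trdeg_unitField hu hu')
  obtain ⟨n, hn⟩ := exists_ringKrullDim_eq_natCast K D
  rw [hn] at hle ⊢
  exact ENat.WithBot.add_one_le_natCast_iff.mp ((add_le_add_right hone _).trans hle)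

theorem proposition3p10 (K D : Type*) [Field K] [CommRing D] [IsDomain D] [Algebra K D]
    [Algebra.FiniteType K D] :
    ringKrullDim (reciprocalComplement D) +
        ((Cardinal.toENat (Algebra.trdeg K (unitField K D)) : ℕ∞) : WithBot ℕ∞) ≤
      ringKrullDim D ∧
    (IsAlgClosed K →
      {d : D | IsUnit d} ≠ algebraMap K D '' {c : K | c ≠ 0} →
      ringKrullDim (reciprocalComplement D) < ringKrullDim D) :=
  ⟨(proposition3p10_general K D).1,
    fun _ h ↦ (proposition3p10_general K D).2 (exists_isUnit_transcendental h)⟩
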